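/- Let $X=\{X_s\}_{s\ge 0}$ be a one-dimensional symmetric Lévy process started at $0$, with (real) characteristic exponent $\Psi:\mathbb{R}\to\mathbb{R}$, i.e. $\mathbb{E}[e^{-ixX_s}]=e^{-s\Psi(x)}$ for all $s\ge 0$, $x\in\mathbb{R}$. Assume that $\Psi(x)=\Psi(|x|)\ge 0$, that $\Psi$ is non-decreasing on $[0,\infty)$, and that for some $\ell\in(0,\infty)$ $$\lim_{x\to 0+}\frac{\Psi(x)}{x^2}=\ell,\qquad \lim_{x\to\infty}\frac{\Psi(x)}{\ln(|x|+1)}=\infty,\qquad \int_{\mathbb{R}}\frac{dx}{1+\Psi(x)}<\infty .$$ Let $f:\mathbb{R}\to\mathbb{R}$ satisfy $f\in L^1(\mathbb{R})\cap L^\infty(\mathbb{R})$, and suppose that its Fourier transform $\widehat f(\xi)=\int_{\mathbb{R}}e^{-i\xi x}f(x)\,dx$ satisfies $\widehat f\in L^1(\mathbb{R})$ and $$\int_{\mathbb{R}}\frac{|\widehat f(x)-\widehat f(0)|}{x^2}\,dx<\infty .$$ Let $\{a(n)\}_{n\in\mathbb{N}}$ be an increasing sequence (not necessarily strictly) of positive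 numbers with $a(n)\to\infty$, and let $t>0$. Then for every $n$ the integral $\int_0^{t^2a(n)^2}f(X_s)\,ds$ exists almost surely and defines a square-integrable random variable, and $$\lim_{n\to\infty}\mathbb{E}\left[\frac{1}{a(n)}\int_0^{t^2a(n)^2}f(X_s)\,ds\right]=\left(\int_{\mathbb{R}}f(x)\,dx\right)\frac{t}{\sqrt{\pi\ell}},$$ $$\lim_{n\to\infty}\mathbb{E}\left[\left(\frac{1}{a(n)}\int_0^{t^2a(n)^2}f(X_s)\,ds\right)^2\right]=\left(\int_{\mathbb{R}}f(x)\,dx\right)^2\frac{t^2}{2\ell}.$$ -/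

import Mathlib

open MeasureTheory ProbabilityTheory Filter Topology
open scoped NNReal ENNReal

namespace LevyFunctional

/-- A real-valued Lévy process started at zero: independent and stationary increments,
almost surely càdlàg paths (stochastic continuity follows from these properties). -/
structure IsLevyProcess {Ω : Type*} [MeasurableSpace Ω] (X : ℝ≥0 → Ω → ℝ) (P : Measure Ω) :
    Prop where
  measurable : ∀ t, Measurable (X t)
  start_zero : ∀ᵐ ω ∂P, X 0 ω = 0
  indep_increments : HasIndepIncrements X P
  stationary_increments : ∀ s h : ℝ≥0,
    IdentDistrib (fun ω => X (s + h) ω - X s ω) (X h) P P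
  cadlag : ∀ᵐ ω ∂P, ∀ t : ℝ≥0,
    ContinuousWithinAt (fun s => X s ω) (Set.Ici t) t ∧
      ∃ l : ℝ, Tendsto (fun s => X s ω) (𝓝[<] t) (𝓝 l)

/-- The process is symmetric: `X t` and `-X t` have the same law for every `t`. -/
def IsSymmetricProcess {Ω : Type*} [MeasurableSpace Ω] (X : ℝ≥0 → Ω → ℝ) (P : Measure Ω) :
    Prop :=
  ∀ t, IdentDistrib (X t) (fun ω => -X t ω) P P

/-- `Ψ` is the characteristic exponent of `X`: `E[exp (-i x X_s)] = exp (-s Ψ(x))`. -/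
def HasCharExponent {Ω : Type*} [MeasurableSpace Ω] (X : ℝ≥0 → Ω → ℝ) (P : Measure Ω)
    (Ψ : ℝ → ℝ) : Prop :=
  ∀ (s : ℝ≥0) (x : ℝ),
    ∫ ω, Complex.exp (-Complex.I * (x : ℂ) * (X s ω : ℂ)) ∂P
      = Complex.exp (-((s : ℝ) : ℂ) * (Ψ x : ℂ))

/-- The standing conditions on the characteristic exponent, with constant `ℓ`. -/
structure IsAdmissibleExponent (Ψ : ℝ → ℝ) (ℓ : ℝ) : Prop where
  even : ∀ x, Ψ x = Ψ |x|
  nonneg : ∀ x, 0 ≤ Ψ x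
  monotoneOn : MonotoneOn Ψ (Set.Ici 0)
  ell_pos : 0 < ℓ
  tendsto_zero : Tendsto (fun x : ℝ => Ψ x / x ^ 2) (𝓝[>] 0) (𝓝 ℓ)
  tendsto_infty : Tendsto (fun x : ℝ => Ψ x / Real.log (|x| + 1)) atTop atTop
  integrable : Integrable (fun x : ℝ => 1 / (1 + Ψ x)) volume

/-- The Fourier transform `f̂(ξ) = ∫ exp (-i ξ x) f(x) dx`. -/
noncomputable def fourierHat (f : ℝ → ℝ) (ξ : ℝ) : ℂ :=
  ∫ x : ℝ, Complex.exp (-Complex.I * (ξ : ℂ) * (x : ℂ)) * (f x : ℂ)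

/-- The class of admissible functions: `f ∈ L¹ ∩ L^∞`, `f̂ ∈ L¹`, and
`|f̂(x) - f̂(0)| / x²` is integrable over the line. -/
structure IsAdmissibleFunction (f : ℝ → ℝ) : Prop where
  integrable : Integrable f volume
  essBounded : MemLp f ∞ volume
  fourier_integrable : Integrable (fourierHat f) volume
  fourier_diff_integrable :
    Integrable (fun x : ℝ => ‖fourierHat f x - fourierHat f 0‖ / x ^ 2) volume

/-- The normalized additive functional `c⁻¹ ∫₀^{t² c²} f(X_s) ds`, as a random variable. -/
noncomputable def additiveFunctional {Ω : Type*} (X : ℝ≥0 → Ω → ℝ) (f : ℝ → ℝ) (c t : ℝ)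
    (ω : Ω) : ℝ :=
  c⁻¹ * ∫ s in (0 : ℝ)..(t ^ 2 * c ^ 2), f (X s.toNNReal ω)

end LevyFunctional

/-! Since `exp (-s Ψ)` is integrable, Fourier inversion gives `X_s` a bounded continuous density
`p_s` for each `s > 0` (`eq_withDensity_invDensity`). Small frequencies, where `Ψ x ~ ℓ x²`, govern
large times: `√s p_s(y) → c = 1 / (2 √(π ℓ))` for every `y` (`tendsto_sqrt_mul_invDensity`), and `√s
p_s` is bounded for `s ≥ 1`. Hence `E[f(X_s)] ~ c (∫ f) / √s`. By independence of increments, the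
mean of `f(X_r) f(X_s)` behaves like `(c ∫ f)² / (√r √(s - r))`.

Substituting `s = a² ρ` absorbs all powers of `a`, and dominated convergence leaves deterministic
integrals of `ρ^(-1/2)` and of `(ρ (σ - ρ))^(-1/2)` over `0 < ρ < σ ≤ t²`. The first is `2t`. The
second is `π t²` because `B(1/2, 1/2) = π`, and it is doubled when the square of a time integral is
written over the triangle.

These arguments need a bounded Borel function and a jointly measurable process. Both replacements
are harmless: `X_s` has a law absolutely continuous with respect to Lebesgue measure, and its paths
are right-continuous almost surely. -/

namespace LevyFunctional

/-! ### Fourier inversion for laws with integrable real characteristic function. -/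

open Complex in
theorem integral_exp_mul_gaussian {ε : ℝ} (hε : 0 < ε) (y : ℝ) :
    ∫ x : ℝ, cexp (I * y * x) * cexp (-ε * x ^ 2)
      = ((Real.sqrt (Real.pi / ε) * Real.exp (-y ^ 2 / (4 * ε)) : ℝ) : ℂ) := by
  rw [fourierIntegral_gaussian (by simpa using hε)]
  push_cast
  congr 1
  rw [Real.sqrt_eq_rpow, ofReal_cpow (by positivity)]
  push_cast
  rfl

open Complex in
/-- Gaussian regularization of the inversion integral of a characteristic function. -/
theorem integral_exp_mul_gaussian_mul_charFun (μ : Measure ℝ) [IsProbabilityMeasure μ]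
    {ε : ℝ} (hε : 0 < ε) (y : ℝ) :
    ∫ x : ℝ, cexp (-I * x * y) * (cexp (-ε * x ^ 2) * charFun μ x)
      = ((∫ z, Real.sqrt (Real.pi / ε) * Real.exp (-(z - y) ^ 2 / (4 * ε)) ∂μ : ℝ) : ℂ) := by
  have hint : Integrable (fun x : ℝ => cexp (-ε * x ^ 2)) := by
    simpa using integrable_cexp_quadratic (b := (ε : ℂ)) (by simpa using hε) 0 0
  calc
    _ = ∫ x : ℝ, ∫ z, cexp (I * ((z - y : ℝ) : ℂ) * x) * cexp (-ε * x ^ 2) ∂μ := by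
      refine integral_congr_ae (.of_forall fun x => ?_)
      simp only [charFun_apply_real]
      rw [← integral_const_mul, ← integral_const_mul]
      refine integral_congr_ae (.of_forall fun z => ?_)
      simp only [← Complex.exp_add]
      congr 1
      push_cast
      ring
    _ = ∫ z, (∫ x : ℝ, cexp (I * ((z - y : ℝ) : ℂ) * x) * cexp (-ε * x ^ 2)) ∂μ := by
      refine integral_integral_swap ?_
      refine ((hint.comp_fst μ)).mono (by fun_prop) (.of_forall fun p => ?_)
      simp only [Function.uncurry, norm_mul]
      rw [show I * ((p.2 - y : ℝ) : ℂ) * p.1 = ((((p.2 - y) * p.1 : ℝ)) : ℂ) * I by push_cast; ring,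
        Complex.norm_exp_ofReal_mul_I, one_mul]
    _ = _ := by
      rw [← integral_complex_ofReal]
      refine integral_congr_ae (.of_forall fun z => ?_)
      exact integral_exp_mul_gaussian hε _

/-- The inversion integral of a real characteristic function. -/
noncomputable def invDensity (φ : ℝ → ℝ) (y : ℝ) : ℝ :=
  (2 * Real.pi)⁻¹ * ∫ x : ℝ, Real.cos (x * y) * φ x

theorem abs_invDensity_le {φ : ℝ → ℝ} (hφ : Integrable φ) (h0 : ∀ x, 0 ≤ φ x) (y : ℝ) :
    |invDensity φ y| ≤ (2 * Real.pi)⁻¹ * ∫ x : ℝ, φ x := by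
  rw [invDensity, abs_mul, abs_of_pos (by positivity)]
  gcongr
  refine (abs_integral_le_integral_abs).trans ?_
  refine integral_mono_of_nonneg (.of_forall fun _ => abs_nonneg _) hφ (.of_forall fun x => ?_)
  simp only [abs_mul, abs_of_nonneg (h0 x)]
  exact mul_le_of_le_one_left (h0 x) (Real.abs_cos_le_one _)

theorem continuous_invDensity {φ : ℝ → ℝ} (hφ : Integrable φ) : Continuous (invDensity φ) := by
  refine continuous_const.mul (continuous_of_dominated (bound := fun x => |φ x|) ?_ ?_ hφ.abs ?_)
  · exact fun y => (by fun_prop : Continuous fun x : ℝ => Real.cos (x * y)).aestronglyMeasurable.mul hφ.1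
  · intro y
    refine .of_forall fun x => ?_
    simp only [Real.norm_eq_abs, abs_mul]
    exact mul_le_of_le_one_left (abs_nonneg _) (Real.abs_cos_le_one _)
  · exact .of_forall fun x => by fun_prop

theorem re_integral_exp_mul_ofReal {φ : ℝ → ℝ} (hφ : Integrable φ) (y : ℝ) :
    (∫ x : ℝ, Complex.exp (-Complex.I * x * y) * (φ x : ℂ)).re
      = ∫ x : ℝ, Real.cos (x * y) * φ x := by
  have hint : Integrable (fun x : ℝ => Complex.exp (-Complex.I * x * y) * (φ x : ℂ)) := by
    refine (hφ.ofReal (𝕜 := ℂ)).mono (Continuous.aestronglyMeasurable (by fun_prop) |>.mul (hφ.ofReal (𝕜 := ℂ)).1)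
      (.of_forall fun x => ?_)
    rw [norm_mul, show -Complex.I * (x : ℂ) * y = ((-(x * y) : ℝ) : ℂ) * Complex.I by
      push_cast; ring, Complex.norm_exp_ofReal_mul_I, one_mul]
    simp
  rw [← Complex.reCLM_apply, ← ContinuousLinearMap.integral_comp_comm _ hint]
  refine integral_congr_ae (.of_forall fun x => ?_)
  simp only [Complex.reCLM_apply]
  rw [Complex.re_mul_ofReal, show -Complex.I * (x : ℂ) * y = ((-(x * y) : ℝ) : ℂ) * Complex.I by
      push_cast; ring, Complex.exp_ofReal_mul_I_re, Real.cos_neg]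

theorem integrable_gaussian_mul {φ : ℝ → ℝ} (hφ : Integrable φ) {ε : ℝ} (hε : 0 ≤ ε) :
    Integrable (fun x => Real.exp (-ε * x ^ 2) * φ x) := by
  refine hφ.mono (Continuous.aestronglyMeasurable (by fun_prop) |>.mul hφ.1)
    (.of_forall fun x => ?_)
  rw [norm_mul, Real.norm_eq_abs, Real.abs_exp]
  refine mul_le_of_le_one_left (norm_nonneg _) (Real.exp_le_one_iff.2 ?_)
  nlinarith [sq_nonneg x]

/-- Gaussian damping of the characteristic function is convolution of `μ` with the normal law of
variance `2 ε`; the right side is the density of that convolution, visibly nonnegative. -/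
theorem invDensity_gaussian (μ : Measure ℝ) [IsProbabilityMeasure μ] {φ : ℝ → ℝ}
    (hφ : Integrable φ) (hμ : ∀ x, charFun μ x = φ x) {ε : ℝ} (hε : 0 < ε) (y : ℝ) :
    invDensity (fun x => Real.exp (-ε * x ^ 2) * φ x) y
      = ∫ z, (2 * Real.pi)⁻¹ * (Real.sqrt (Real.pi / ε) * Real.exp (-(z - y) ^ 2 / (4 * ε))) ∂μ := by
  rw [invDensity, ← re_integral_exp_mul_ofReal (integrable_gaussian_mul hφ hε.le),
    integral_const_mul]
  congr 1
  have := integral_exp_mul_gaussian_mul_charFun μ hε y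
  simp only [hμ] at this
  push_cast
  rw [this, Complex.ofReal_re]

theorem tendsto_invDensity_gaussian {φ : ℝ → ℝ} (hφ : Integrable φ) (y : ℝ) :
    Tendsto (fun n : ℕ => invDensity (fun x => Real.exp (-(1 / ((n : ℝ) + 1)) * x ^ 2) * φ x) y)
      atTop (𝓝 (invDensity φ y)) := by
  refine Tendsto.const_mul _ (tendsto_integral_of_dominated_convergence (fun x => |φ x|) ?_
    hφ.abs ?_ ?_)
  · exact fun n => (by fun_prop : Continuous fun x : ℝ => Real.cos (x * y)).aestronglyMeasurable.mul
      (integrable_gaussian_mul hφ (by positivity)).1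
  · intro n
    refine .of_forall fun x => ?_
    simp only [Real.norm_eq_abs, abs_mul, Real.abs_exp]
    have h1 := Real.abs_cos_le_one (x * y)
    have h2 : Real.exp (-(1 / ((n : ℝ) + 1)) * x ^ 2) ≤ 1 := by
      refine Real.exp_le_one_iff.2 ?_
      have : 0 ≤ (1 / ((n : ℝ) + 1)) * x ^ 2 := by positivity
      linarith
    calc _ ≤ 1 * (1 * |φ x|) := by gcongr
      _ = _ := by ring
  · refine .of_forall fun x => ?_
    have : Tendsto (fun n : ℕ => Real.exp (-(1 / ((n : ℝ) + 1)) * x ^ 2)) atTop (𝓝 1) := by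
      have h := (tendsto_one_div_add_atTop_nhds_zero_nat (𝕜 := ℝ)).neg.mul_const (x ^ 2)
      simpa [Function.comp_def] using (Real.continuous_exp.tendsto _).comp h
    simpa using (this.mul_const (φ x)).const_mul (Real.cos (x * y))

theorem invDensity_nonneg (μ : Measure ℝ) [IsProbabilityMeasure μ] {φ : ℝ → ℝ}
    (hφ : Integrable φ) (hμ : ∀ x, charFun μ x = φ x) (y : ℝ) : 0 ≤ invDensity φ y := by
  refine ge_of_tendsto' (tendsto_invDensity_gaussian hφ y) fun n => ?_
  rw [invDensity_gaussian μ hφ hμ (by positivity)]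
  exact integral_nonneg fun z => by positivity

theorem lintegral_gaussian_kernel {ε : ℝ} (hε : 0 < ε) (z : ℝ) :
    ∫⁻ y, ENNReal.ofReal
      ((2 * Real.pi)⁻¹ * (Real.sqrt (Real.pi / ε) * Real.exp (-(z - y) ^ 2 / (4 * ε)))) = 1 := by
  have hG : Integrable (fun y : ℝ => Real.exp (-(1 / (4 * ε)) * y ^ 2)) :=
    integrable_exp_neg_mul_sq (by positivity)
  have hI : ∀ y : ℝ, (2 * Real.pi)⁻¹ * (Real.sqrt (Real.pi / ε)
      * Real.exp (-(z - y) ^ 2 / (4 * ε)))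
      = ((2 * Real.pi)⁻¹ * Real.sqrt (Real.pi / ε)) * Real.exp (-(1 / (4 * ε)) * (z - y) ^ 2) := by
    intro y
    rw [mul_assoc]
    congr 3
    ring
  simp_rw [hI]
  rw [← ofReal_integral_eq_lintegral_ofReal ((hG.comp_sub_left z).const_mul _)
    (.of_forall fun y => by positivity), integral_const_mul,
    integral_sub_left_eq_self (fun y : ℝ => Real.exp (-(1 / (4 * ε)) * y ^ 2)),
    integral_gaussian, mul_assoc, ← Real.sqrt_mul (by positivity)]
  have : Real.pi / ε * (Real.pi / (1 / (4 * ε))) = (2 * Real.pi) ^ 2 := by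
    field_simp
    norm_num
  rw [this, Real.sqrt_sq (by positivity), inv_mul_cancel₀ (by positivity), ENNReal.ofReal_one]

/-- Fatou's lemma: the regularized densities all have mass one and converge pointwise. Mass at most
one in the limit suffices here. -/
theorem integrable_invDensity (μ : Measure ℝ) [IsProbabilityMeasure μ] {φ : ℝ → ℝ}
    (hφ : Integrable φ) (hμ : ∀ x, charFun μ x = φ x) : Integrable (invDensity φ) := by
  refine ⟨(continuous_invDensity hφ).aestronglyMeasurable, ?_⟩
  rw [hasFiniteIntegral_iff_ofReal (.of_forall (invDensity_nonneg μ hφ hμ))]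
  refine lt_of_le_of_lt ?_ ENNReal.one_lt_top
  set q : ℕ → ℝ → ℝ := fun n => invDensity (fun x => Real.exp (-(1 / ((n : ℝ) + 1)) * x ^ 2) * φ x)
  calc
    ∫⁻ y, ENNReal.ofReal (invDensity φ y)
      = ∫⁻ y, liminf (fun n => ENNReal.ofReal (q n y)) atTop := by
        refine lintegral_congr fun y => ?_
        exact ((ENNReal.continuous_ofReal.tendsto _).comp
          (tendsto_invDensity_gaussian hφ y)).liminf_eq.symm
    _ ≤ liminf (fun n => ∫⁻ y, ENNReal.ofReal (q n y)) atTop := by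
        refine lintegral_liminf_le fun n => ENNReal.measurable_ofReal.comp ?_
        exact (continuous_invDensity (integrable_gaussian_mul hφ (by positivity))).measurable
    _ = liminf (fun _ : ℕ => (1 : ℝ≥0∞)) atTop := by
        congr 1
        funext n
        have hε : (0 : ℝ) < 1 / ((n : ℝ) + 1) := by positivity
        have hint : ∀ y : ℝ, Integrable (fun z => (2 * Real.pi)⁻¹ *
            (Real.sqrt (Real.pi / (1 / ((n : ℝ) + 1))) *
              Real.exp (-(z - y) ^ 2 / (4 * (1 / ((n : ℝ) + 1)))))) μ := by
          intro y
          refine Integrable.of_bound (by fun_prop)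
            ((2 * Real.pi)⁻¹ * (Real.sqrt (Real.pi / (1 / ((n : ℝ) + 1))) * 1))
            (.of_forall fun z => ?_)
          rw [Real.norm_of_nonneg (by positivity)]
          gcongr
          refine Real.exp_le_one_iff.2 (div_nonpos_of_nonpos_of_nonneg ?_ (by positivity))
          nlinarith [sq_nonneg (z - y)]
        simp only [q, invDensity_gaussian μ hφ hμ hε]
        have : ∀ y, ENNReal.ofReal (∫ z, (2 * Real.pi)⁻¹ *
            (Real.sqrt (Real.pi / (1 / ((n : ℝ) + 1))) *
              Real.exp (-(z - y) ^ 2 / (4 * (1 / ((n : ℝ) + 1))))) ∂μ)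
            = ∫⁻ z, ENNReal.ofReal ((2 * Real.pi)⁻¹ *
            (Real.sqrt (Real.pi / (1 / ((n : ℝ) + 1))) *
              Real.exp (-(z - y) ^ 2 / (4 * (1 / ((n : ℝ) + 1)))))) ∂μ :=
          fun y => ofReal_integral_eq_lintegral_ofReal (hint y) (.of_forall fun z => by positivity)
        simp_rw [this]
        rw [lintegral_lintegral_swap (by fun_prop)]
        simp_rw [lintegral_gaussian_kernel hε]
        simp
    _ ≤ 1 := by simp

theorem even_of_charFun_eq_ofReal {μ : Measure ℝ} {φ : ℝ → ℝ}
    (hμ : ∀ x, charFun μ x = φ x) (x : ℝ) : φ (-x) = φ x := by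
  have h := charFun_neg (μ := μ) x
  rw [hμ, hμ, Complex.conj_ofReal] at h
  exact_mod_cast h

theorem integral_exp_mul_ofReal_of_even {φ : ℝ → ℝ} (hφ : Integrable φ)
    (heven : ∀ x, φ (-x) = φ x) (y : ℝ) :
    ∫ x : ℝ, Complex.exp (-Complex.I * x * y) * (φ x : ℂ)
      = ((∫ x : ℝ, Real.cos (x * y) * φ x : ℝ) : ℂ) := by
  rw [← re_integral_exp_mul_ofReal hφ]
  refine (Complex.conj_eq_iff_re.1 ?_).symm
  rw [← integral_conj, ← integral_neg_eq_self]
  refine integral_congr_ae (.of_forall fun x => ?_)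
  simp only [map_mul, Complex.conj_ofReal, heven, ← Complex.exp_conj]
  simp

-- The dilation by `2π` converts between the convention of `𝓕` and that of `charFun`.
open FourierTransform in
theorem fourier_eq_invDensity {φ : ℝ → ℝ} (hφ : Integrable φ)
    (heven : ∀ x, φ (-x) = φ x) (y : ℝ) :
    𝓕 (fun ξ : ℝ => (φ (2 * Real.pi * ξ) : ℂ)) y = invDensity φ y := by
  rw [Real.fourier_eq']
  have h := Measure.integral_comp_mul_left
    (fun x : ℝ => Complex.exp (-Complex.I * x * y) * (φ x : ℂ)) (2 * Real.pi)
  rw [integral_exp_mul_ofReal_of_even hφ heven, abs_of_pos (by positivity)] at h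
  rw [invDensity]
  push_cast at h ⊢
  rw [Complex.real_smul] at h
  push_cast at h
  rw [← h]
  refine integral_congr_ae (.of_forall fun x => ?_)
  simp only [smul_eq_mul, RCLike.inner_apply, conj_trivial]
  congr 2
  push_cast
  ring

open FourierTransform in
/-- A probability measure with integrable real characteristic function has the continuous density
given by the inversion integral. -/
theorem eq_withDensity_invDensity (μ : Measure ℝ) [IsProbabilityMeasure μ] {φ : ℝ → ℝ}
    (hφ : Integrable φ) (hμ : ∀ x, charFun μ x = φ x) :
    μ = volume.withDensity (fun y => ENNReal.ofReal (invDensity φ y)) := by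
  have hp := integrable_invDensity μ hφ hμ
  have hp0 := invDensity_nonneg μ hφ hμ
  have heven := even_of_charFun_eq_ofReal hμ
  have : IsFiniteMeasure (volume.withDensity (fun y => ENNReal.ofReal (invDensity φ y))) :=
    isFiniteMeasure_withDensity_ofReal hp.2
  set Φ : ℝ → ℂ := fun ξ => (φ (2 * Real.pi * ξ) : ℂ) with hΦ
  have hΦF : 𝓕 Φ = fun y => (invDensity φ y : ℂ) := funext (fourier_eq_invDensity hφ heven)
  have hΦc : Continuous Φ := by
    have : Continuous fun x => (φ x : ℂ) := by
      simp_rw [← hμ]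
      exact continuous_charFun
    exact this.comp (by fun_prop : Continuous fun ξ : ℝ => 2 * Real.pi * ξ)
  have hΦi : Integrable Φ := (hφ.comp_mul_left' (by positivity)).ofReal
  -- Inversion holds pointwise since `Φ` is continuous and both it and its transform are integrable;
  -- at `t / (2π)` it identifies the characteristic function of the candidate density.
  have hinv := hΦc.fourierInv_fourier_eq hΦi (by rw [hΦF]; exact hp.ofReal)
  refine Measure.ext_of_charFun (funext fun t => ?_)
  rw [hμ, charFun_apply_real, integral_withDensity_eq_integral_toReal_smul
    (continuous_invDensity hφ).measurable.ennreal_ofReal (.of_forall fun _ => ENNReal.ofReal_lt_top)]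
  have := congrFun hinv (t / (2 * Real.pi))
  rw [hΦF, Real.fourierInv_eq', hΦ] at this
  simp only [mul_div_cancel₀ t (by positivity : 2 * Real.pi ≠ 0)] at this
  rw [← this]
  refine integral_congr_ae (.of_forall fun x => ?_)
  simp only [ENNReal.toReal_ofReal (hp0 x), Complex.real_smul, smul_eq_mul, RCLike.inner_apply,
    conj_trivial]
  rw [mul_comm]
  congr 2
  push_cast
  field_simp

/-! ### The exponent and the local limit theorem. -/

namespace IsAdmissibleExponent

variable {Ψ : ℝ → ℝ} {ℓ : ℝ}

theorem apply_neg (h : IsAdmissibleExponent Ψ ℓ) (x : ℝ) : Ψ (-x) = Ψ x := by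
  rw [h.even, abs_neg, ← h.even]

theorem measurable (h : IsAdmissibleExponent Ψ ℓ) : Measurable Ψ := by
  have h1 : Monotone (fun x : ℝ => Ψ (max x 0)) := fun x y hxy =>
    h.monotoneOn (Set.mem_Ici.2 (le_max_right _ _)) (Set.mem_Ici.2 (le_max_right _ _))
      (max_le_max_right 0 hxy)
  have h2 : Ψ = (fun x : ℝ => Ψ (max x 0)) ∘ fun x => |x| := by
    funext x
    simp only [Function.comp, max_eq_left (abs_nonneg x)]
    exact h.even x
  rw [h2]
  exact h1.measurable.comp (by fun_prop)

theorem exists_quadratic_lower_bound (h : IsAdmissibleExponent Ψ ℓ) :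
    ∃ δ > 0, ∀ x : ℝ, |x| ≤ δ → ℓ / 2 * x ^ 2 ≤ Ψ x := by
  have h1 := h.tendsto_zero.eventually_const_lt (half_lt_self h.ell_pos)
  obtain ⟨b, hb, hsub⟩ := mem_nhdsGT_iff_exists_Ioc_subset.1 h1
  refine ⟨b, hb, fun x hx => ?_⟩
  rcases eq_or_ne x 0 with rfl | hx0
  · simpa using h.nonneg 0
  · have h2 : ℓ / 2 < Ψ |x| / |x| ^ 2 := hsub ⟨abs_pos.2 hx0, hx⟩
    rw [lt_div_iff₀ (by positivity), sq_abs, ← h.even] at h2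
    exact h2.le

/-- Beyond some `R`, `Ψ` exceeds `(2 / s) log (1 + |x|)`, so the integrand is at most `(1 + |x|)⁻²`;
the factor `(1 + |R|)²` covers the remaining `x`. -/
theorem integrable_exp (h : IsAdmissibleExponent Ψ ℓ) {s : ℝ} (hs : 0 < s) :
    Integrable (fun x => Real.exp (-s * Ψ x)) := by
  have h1 := (h.tendsto_infty.eventually_ge_atTop (2 / s)).and (eventually_gt_atTop 0)
  obtain ⟨R, hR⟩ := eventually_atTop.1 h1
  have hint : Integrable (fun x : ℝ => (1 + |R|) ^ 2 * (1 + ‖x‖) ^ (-(2 : ℝ))) :=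
    (integrable_one_add_norm (by simp)).const_mul _
  refine hint.mono (h.measurable.const_mul _).exp.aestronglyMeasurable (.of_forall fun x => ?_)
  rw [Real.norm_eq_abs, Real.abs_exp, Real.norm_of_nonneg (by positivity), Real.norm_eq_abs,
    Real.rpow_neg (by positivity), Real.rpow_two, ← div_eq_mul_inv, le_div_iff₀ (by positivity)]
  rcases le_total R |x| with hx | hx
  · obtain ⟨h2, h3⟩ := hR _ hx
    rw [abs_abs] at h2
    have hlog : 0 < Real.log (|x| + 1) := Real.log_pos (by linarith)
    rw [le_div_iff₀ hlog, ← h.even, div_mul_eq_mul_div, div_le_iff₀ hs] at h2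
    have h4 : (1 + |x|) ^ 2 = Real.exp (2 * Real.log (|x| + 1)) := by
      rw [mul_comm, Real.exp_mul, Real.exp_log (by positivity), Real.rpow_two, add_comm]
    rw [h4, ← Real.exp_add]
    refine (Real.exp_le_one_iff.2 (by linarith)).trans ?_
    nlinarith [abs_nonneg R]
  · have h2 : Real.exp (-s * Ψ x) ≤ 1 := Real.exp_le_one_iff.2 (by nlinarith [h.nonneg x])
    have h3 : |x| ≤ |R| := hx.trans (le_abs_self R)
    calc _ ≤ 1 * (1 + |R|) ^ 2 := by gcongr
      _ = _ := one_mul _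

theorem tendsto_scaled (h : IsAdmissibleExponent Ψ ℓ) {z : ℝ} (hz : z ≠ 0) :
    Tendsto (fun s : ℝ => s * Ψ (z / Real.sqrt s)) atTop (𝓝 (ℓ * z ^ 2)) := by
  have h1 : Tendsto (fun s : ℝ => |z| / Real.sqrt s) atTop (𝓝[>] 0) := by
    refine tendsto_nhdsWithin_iff.2 ⟨Real.tendsto_sqrt_atTop.const_div_atTop _, ?_⟩
    filter_upwards [eventually_gt_atTop 0] with s hs
    exact div_pos (abs_pos.2 hz) (Real.sqrt_pos.2 hs)
  refine ((h.tendsto_zero.comp h1).mul_const (z ^ 2)).congr' ?_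
  filter_upwards [eventually_gt_atTop 0] with s hs
  have h2 : Ψ (z / Real.sqrt s) = Ψ (|z| / Real.sqrt s) := by
    rw [h.even, abs_div, abs_of_pos (Real.sqrt_pos.2 hs)]
  simp only [Function.comp]
  rw [h2, div_pow, Real.sq_sqrt hs.le, sq_abs]
  field_simp

/-- The constant in the local limit theorem: the density at `0` of the centred normal law with
variance `2 ℓ`. -/
noncomputable def llt (ℓ : ℝ) : ℝ := (2 * Real.sqrt (Real.pi * ℓ))⁻¹

/-- Laplace's method. On `|x| ≤ δ` the substitution `x = z / √s` leads to the integral of `exp (-ℓ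
z²)`, with Gaussian domination from the quadratic lower bound. The rest is exponentially small
because `Ψ ≥ Ψ δ > 0` there. -/
theorem tendsto_sqrt_mul_invDensity (h : IsAdmissibleExponent Ψ ℓ) (y : ℝ) :
    Tendsto (fun s : ℝ => Real.sqrt s * invDensity (fun x => Real.exp (-s * Ψ x)) y) atTop
      (𝓝 (llt ℓ)) := by
  obtain ⟨δ, hδ, hquad⟩ := h.exists_quadratic_lower_bound
  set F : ℝ → ℝ → ℝ := fun s x => Real.cos (x * y) * Real.exp (-s * Ψ x)
  set B : Set ℝ := {x | |x| ≤ δ}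
  have hB : MeasurableSet B := measurableSet_le (by fun_prop) measurable_const
  have hFm : ∀ s, Measurable (F s) := fun s =>
    (by fun_prop : Continuous fun x : ℝ => Real.cos (x * y)).measurable.mul
      (h.measurable.const_mul _).exp
  have hFle : ∀ s x, ‖F s x‖ ≤ Real.exp (-s * Ψ x) := fun s x => by
    rw [Real.norm_eq_abs, abs_mul, Real.abs_exp]
    exact mul_le_of_le_one_left (Real.exp_nonneg _) (Real.abs_cos_le_one _)
  have hFi : ∀ s, 0 < s → Integrable (F s) := fun s hs =>
    (h.integrable_exp hs).mono' (hFm s).aestronglyMeasurable (.of_forall (hFle s))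
  have hinner : Tendsto (fun s : ℝ => Real.sqrt s * ∫ x in B, F s x) atTop
      (𝓝 (Real.sqrt (Real.pi / ℓ))) := by
    have hrw : ∀ᶠ s : ℝ in atTop, ∫ z, B.indicator (F s) (z / Real.sqrt s)
        = Real.sqrt s * ∫ x in B, F s x := by
      filter_upwards [eventually_gt_atTop 0] with s hs
      rw [Measure.integral_comp_div (B.indicator (F s)), abs_of_pos (Real.sqrt_pos.2 hs),
        integral_indicator hB, smul_eq_mul]
    refine Tendsto.congr' hrw ?_
    rw [← integral_gaussian ℓ]
    refine tendsto_integral_filter_of_dominated_convergence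
      (fun z => Real.exp (-(ℓ / 2) * z ^ 2)) ?_ ?_
      (integrable_exp_neg_mul_sq (half_pos h.ell_pos)) ?_
    · refine .of_forall fun s => Measurable.aestronglyMeasurable ?_
      exact ((hFm s).indicator hB).comp (by fun_prop)
    · filter_upwards [eventually_gt_atTop 0] with s hs
      refine .of_forall fun z => ?_
      by_cases hz : z / Real.sqrt s ∈ B
      · rw [Set.indicator_of_mem hz]
        refine (hFle _ _).trans (Real.exp_le_exp.2 ?_)
        have := hquad _ hz
        rw [div_pow, Real.sq_sqrt hs.le] at this
        have h3 : s * (ℓ / 2 * (z ^ 2 / s)) ≤ s * Ψ (z / Real.sqrt s) := by gcongr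
        have h4 : s * (ℓ / 2 * (z ^ 2 / s)) = ℓ / 2 * z ^ 2 := by field_simp
        linarith
      · rw [Set.indicator_of_notMem hz]
        simpa using Real.exp_nonneg _
    · have hne : ∀ᵐ z : ℝ, z ≠ 0 := by simp [ae_iff]
      filter_upwards [hne] with z hz
      have hz0 : Tendsto (fun s : ℝ => z / Real.sqrt s) atTop (𝓝 0) :=
        Real.tendsto_sqrt_atTop.const_div_atTop _
      have hlim : Tendsto (fun s : ℝ => F s (z / Real.sqrt s)) atTop
          (𝓝 (Real.exp (-ℓ * z ^ 2))) := by
        have h1 : Tendsto (fun s : ℝ => Real.cos (z / Real.sqrt s * y)) atTop (𝓝 1) := by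
          simpa [Function.comp_def] using (Real.continuous_cos.tendsto _).comp (hz0.mul_const y)
        have h2 := (Real.continuous_exp.tendsto _).comp (h.tendsto_scaled hz).neg
        simpa [Function.comp_def, F] using h1.mul h2
      refine hlim.congr' ?_
      have : ∀ᶠ s : ℝ in atTop, |z / Real.sqrt s| < δ :=
        (by simpa using hz0.abs : Tendsto (fun s : ℝ => |z / Real.sqrt s|) atTop (𝓝 0)).eventually_lt_const hδ
      filter_upwards [this] with s hs
      rw [Set.indicator_of_mem (show z / Real.sqrt s ∈ B from hs.le)]
  have houter : Tendsto (fun s : ℝ => Real.sqrt s * ∫ x in Bᶜ, F s x) atTop (𝓝 0) := by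
    set κ := Ψ δ
    have hκ : 0 < κ := by
      have := hquad δ (abs_of_pos hδ).le
      have := h.ell_pos
      have : 0 < ℓ / 2 * δ ^ 2 := by positivity
      linarith
    set J := ∫ x, Real.exp (-1 * Ψ x)
    have hlim : Tendsto (fun s : ℝ => (Real.exp κ * J) * (s ^ (1 / 2 : ℝ) * Real.exp (-κ * s))) atTop
        (𝓝 0) := by
      simpa using (tendsto_rpow_mul_exp_neg_mul_atTop_nhds_zero (1 / 2) κ hκ).const_mul
        (Real.exp κ * J)
    refine squeeze_zero_norm' ?_ hlim
    filter_upwards [eventually_ge_atTop 1] with s hs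
    rw [norm_mul, Real.norm_of_nonneg (Real.sqrt_nonneg s), Real.sqrt_eq_rpow]
    -- One unit of time is kept back so that `exp (-Ψ)` supplies integrability; the other `s - 1`
    -- units give the decay.
    have hbd : ‖∫ x in Bᶜ, F s x‖ ≤ Real.exp (-(s - 1) * κ) * J := by
      rw [← integral_indicator hB.compl, ← integral_const_mul]
      refine norm_integral_le_of_norm_le ((h.integrable_exp one_pos).const_mul _)
        (.of_forall fun x => ?_)
      by_cases hx : x ∈ Bᶜ
      · rw [Set.indicator_of_mem hx]
        refine (hFle _ _).trans ?_
        rw [← Real.exp_add, Real.exp_le_exp]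
        have hx' : δ < |x| := not_le.1 hx
        have : κ ≤ Ψ x := by
          rw [h.even x]
          exact h.monotoneOn hδ.le (abs_nonneg x) hx'.le
        nlinarith
      · rw [Set.indicator_of_notMem hx]
        simpa using by positivity
    calc _ ≤ s ^ (1 / 2 : ℝ) * (Real.exp (-(s - 1) * κ) * J) := by gcongr
      _ = _ := by
        rw [show -(s - 1) * κ = κ + -κ * s by ring, Real.exp_add]
        ring
  have hsum := (hinner.add houter).const_mul (2 * Real.pi)⁻¹
  have hc : (2 * Real.pi)⁻¹ * (Real.sqrt (Real.pi / ℓ) + 0) = llt ℓ := by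
    have hl := h.ell_pos
    rw [llt, add_zero, Real.sqrt_div' _ hl.le, Real.sqrt_mul Real.pi_pos.le]
    have : Real.sqrt Real.pi ^ 2 = Real.pi := Real.sq_sqrt Real.pi_pos.le
    have h1 : 0 < Real.sqrt ℓ := Real.sqrt_pos.2 hl
    field_simp
    rw [this]
  rw [hc] at hsum
  refine hsum.congr' ?_
  filter_upwards [eventually_gt_atTop 0] with s hs
  rw [invDensity, ← integral_add_compl hB (hFi s hs)]
  ring

/-- The uniform bound `√s p_s ≤ C` for large times. -/
theorem exists_sqrt_mul_integral_exp_le (h : IsAdmissibleExponent Ψ ℓ) :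
    ∃ C, ∀ s : ℝ, 1 ≤ s →
      Real.sqrt s * ((2 * Real.pi)⁻¹ * ∫ x, Real.exp (-s * Ψ x)) ≤ C := by
  -- At `y = 0` the cosine is `1`, so the limit controls the full integral, which dominates the
  -- density at every point. Times in `[1, S]` are handled by monotonicity in `s`.
  have h0 := h.tendsto_sqrt_mul_invDensity 0
  simp only [invDensity, mul_zero, Real.cos_zero, one_mul] at h0
  obtain ⟨S, hS⟩ := eventually_atTop.1 (h0.eventually_le_const (lt_add_one (llt ℓ)))
  refine ⟨max (llt ℓ + 1) (Real.sqrt S * ((2 * Real.pi)⁻¹ * ∫ x, Real.exp (-1 * Ψ x))),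
    fun s hs => ?_⟩
  rcases le_total S s with hSs | hsS
  · exact (hS s hSs).trans (le_max_left _ _)
  · refine le_trans ?_ (le_max_right _ _)
    gcongr ?_ * (_ * ?_)
    · exact Real.sqrt_le_sqrt hsS
    · refine integral_mono (h.integrable_exp (by linarith)) (h.integrable_exp one_pos) fun x => ?_
      refine Real.exp_le_exp.2 ?_
      nlinarith [h.nonneg x]

end IsAdmissibleExponent

/-! ### Asymptotics and bounds for one- and two-time means. -/

/-- A family of probability laws with characteristic functions `exp (-s Ψ)`. -/
structure HasExponentLaws (μ : ℝ → Measure ℝ) (Ψ : ℝ → ℝ) : Prop where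
  isProb : ∀ s, IsProbabilityMeasure (μ s)
  charFun_eq : ∀ s, 0 < s → ∀ x, charFun (μ s) x = (Real.exp (-s * Ψ x) : ℝ)

/-- Bounded integrable Borel functions. -/
structure IsNice (g : ℝ → ℝ) (M : ℝ) : Prop where
  measurable : Measurable g
  integrable : Integrable g
  bound : ∀ x, |g x| ≤ M

theorem IsNice.abs {g : ℝ → ℝ} {M : ℝ} (hg : IsNice g M) : IsNice (fun x => |g x|) M :=
  ⟨hg.measurable.abs, hg.integrable.abs, fun x => by simpa using hg.bound x⟩

theorem IsNice.bound_nonneg {g : ℝ → ℝ} {M : ℝ} (hg : IsNice g M) : 0 ≤ M :=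
  (abs_nonneg _).trans (hg.bound 0)

/-- The expectation of `g` started at `x`, under the law `μ s`. -/
noncomputable def transition (μ : ℝ → Measure ℝ) (s : ℝ) (g : ℝ → ℝ) (x : ℝ) : ℝ :=
  ∫ y, g (x + y) ∂μ s

namespace HasExponentLaws

variable {μ : ℝ → Measure ℝ} {Ψ : ℝ → ℝ} {ℓ : ℝ} {g : ℝ → ℝ} {M : ℝ}

theorem eq_withDensity (hμ : HasExponentLaws μ Ψ) (h : IsAdmissibleExponent Ψ ℓ) {s : ℝ}
    (hs : 0 < s) : μ s = volume.withDensity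
      (fun y => ENNReal.ofReal (invDensity (fun x => Real.exp (-s * Ψ x)) y)) :=
  have := hμ.isProb s
  eq_withDensity_invDensity (μ s) (h.integrable_exp hs) (hμ.charFun_eq s hs)

theorem absolutelyContinuous (hμ : HasExponentLaws μ Ψ) (h : IsAdmissibleExponent Ψ ℓ) {s : ℝ}
    (hs : 0 < s) : μ s ≪ volume := by
  rw [hμ.eq_withDensity h hs]
  exact withDensity_absolutelyContinuous _ _

theorem integral_eq (hμ : HasExponentLaws μ Ψ) (h : IsAdmissibleExponent Ψ ℓ) {s : ℝ}
    (hs : 0 < s) (g : ℝ → ℝ) :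
    ∫ y, g y ∂μ s = ∫ y, invDensity (fun x => Real.exp (-s * Ψ x)) y * g y := by
  have := hμ.isProb s
  have hint := h.integrable_exp hs
  have h0 := invDensity_nonneg (μ s) hint (hμ.charFun_eq s hs)
  rw [hμ.eq_withDensity h hs, integral_withDensity_eq_integral_toReal_smul
    (continuous_invDensity hint).measurable.ennreal_ofReal
    (.of_forall fun _ => ENNReal.ofReal_lt_top)]
  simp only [ENNReal.toReal_ofReal (h0 _), smul_eq_mul]

theorem transition_eq (hμ : HasExponentLaws μ Ψ) (h : IsAdmissibleExponent Ψ ℓ) {s : ℝ}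
    (hs : 0 < s) (g : ℝ → ℝ) (x : ℝ) :
    transition μ s g x = ∫ z, invDensity (fun x => Real.exp (-s * Ψ x)) (z - x) * g z := by
  rw [transition, hμ.integral_eq h hs, ← integral_sub_right_eq_self _ x]
  simp

theorem tendsto_sqrt_mul_transition (hμ : HasExponentLaws μ Ψ) (h : IsAdmissibleExponent Ψ ℓ)
    (hg : Integrable g) (x : ℝ) :
    Tendsto (fun s => Real.sqrt s * transition μ s g x) atTop
      (𝓝 (IsAdmissibleExponent.llt ℓ * ∫ z, g z)) := by
  obtain ⟨C, hC⟩ := h.exists_sqrt_mul_integral_exp_le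
  have : Tendsto (fun s => ∫ z, Real.sqrt s *
      invDensity (fun x => Real.exp (-s * Ψ x)) (z - x) * g z) atTop
      (𝓝 (∫ z, IsAdmissibleExponent.llt ℓ * g z)) := by
    refine tendsto_integral_filter_of_dominated_convergence (fun z => C * |g z|) ?_ ?_
      (hg.abs.const_mul C) (.of_forall fun z => ?_)
    · filter_upwards [eventually_gt_atTop 0] with s hs
      refine AEStronglyMeasurable.mul (Continuous.aestronglyMeasurable ?_) hg.1
      have := continuous_invDensity (h.integrable_exp hs)
      fun_prop
    · filter_upwards [eventually_ge_atTop 1] with s hs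
      refine .of_forall fun z => ?_
      rw [norm_mul, norm_mul, Real.norm_of_nonneg (Real.sqrt_nonneg s)]
      refine mul_le_mul_of_nonneg_right (le_trans ?_ (hC s hs)) (norm_nonneg _)
      gcongr
      exact abs_invDensity_le (h.integrable_exp (by linarith)) (fun _ => Real.exp_nonneg _) _
    · exact (h.tendsto_sqrt_mul_invDensity (z - x)).mul_const (g z)
  rw [integral_const_mul] at this
  refine this.congr' ?_
  filter_upwards [eventually_gt_atTop 0] with s hs
  rw [hμ.transition_eq h hs, ← integral_const_mul]
  simp only [mul_assoc]

/-- For `s ≤ 1` boundedness of `g` is enough; for `s ≥ 1` the density bound is integrated against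
`|g|`. Uniformity in `x` allows the bound to be iterated over two times. -/
theorem exists_sqrt_mul_transition_abs_le (hμ : HasExponentLaws μ Ψ)
    (h : IsAdmissibleExponent Ψ ℓ) (hg : IsNice g M) :
    ∃ C, 0 ≤ C ∧ ∀ s, 0 < s → ∀ x,
      Real.sqrt s * transition μ s (fun y => |g y|) x ≤ C := by
  obtain ⟨C, hC⟩ := h.exists_sqrt_mul_integral_exp_le
  have hM := hg.bound_nonneg
  refine ⟨max M (C * ∫ z, |g z|), hM.trans (le_max_left _ _), fun s hs x => ?_⟩
  have := hμ.isProb s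
  rcases le_total s 1 with h1 | h1
  · refine le_trans ?_ (le_max_left _ _)
    have h2 : transition μ s (fun y => |g y|) x ≤ M := by
      calc transition μ s (fun y => |g y|) x ≤ ∫ _, M ∂μ s :=
            integral_mono_of_nonneg (.of_forall fun _ => abs_nonneg _) (integrable_const _)
              (.of_forall fun y => hg.bound _)
        _ = M := by simp
    calc _ ≤ 1 * M := by
          gcongr
          · exact integral_nonneg fun _ => abs_nonneg _
          · exact Real.sqrt_le_one.2 h1
      _ = M := one_mul M
  · refine le_trans ?_ (le_max_right _ _)
    rw [hμ.transition_eq h hs, ← integral_const_mul, ← integral_const_mul]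
    refine integral_mono_of_nonneg (.of_forall fun z => ?_) (hg.integrable.abs.const_mul C)
      (.of_forall fun z => ?_)
    · have := invDensity_nonneg (μ s) (h.integrable_exp hs) (hμ.charFun_eq s hs) (z - x)
      simp only [Pi.zero_apply]
      positivity
    · simp only [← mul_assoc]
      refine mul_le_mul_of_nonneg_right (le_trans ?_ (hC s h1)) (abs_nonneg _)
      gcongr
      exact (le_abs_self _).trans
        (abs_invDensity_le (h.integrable_exp hs) (fun _ => Real.exp_nonneg _) _)

theorem abs_transition_le (g : ℝ → ℝ) (s x : ℝ) :
    |transition μ s g x| ≤ transition μ s (fun y => |g y|) x :=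
  abs_integral_le_integral_abs

theorem measurable_transition (hμ : HasExponentLaws μ Ψ) (hg : Measurable g) (s : ℝ) :
    Measurable (transition μ s g) := by
  have := hμ.isProb s
  exact (StronglyMeasurable.integral_prod_right' (f := fun p : ℝ × ℝ => g (p.1 + p.2)) (ν := μ s)
    (hg.comp (by fun_prop)).stronglyMeasurable).measurable

/-- Two-time mean `∫ g(x) E_x[g(X_u)] μ_r(dx)`: domination. -/
theorem exists_abs_pair_le (hμ : HasExponentLaws μ Ψ) (h : IsAdmissibleExponent Ψ ℓ)
    (hg : IsNice g M) :
    ∃ C, 0 ≤ C ∧ (∀ s, 0 < s → |transition μ s g 0| ≤ C / Real.sqrt s) ∧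
      ∀ r u, 0 < r → 0 < u →
        |transition μ r (fun x => g x * transition μ u g x) 0|
          ≤ C ^ 2 / (Real.sqrt r * Real.sqrt u) := by
  obtain ⟨C, hC0, hC⟩ := hμ.exists_sqrt_mul_transition_abs_le h hg
  refine ⟨C, hC0, fun s hs => ?_, fun r u hr hu => ?_⟩
  · rw [le_div_iff₀' (Real.sqrt_pos.2 hs)]
    refine le_trans ?_ (hC s hs 0)
    gcongr
    exact abs_transition_le _ _ _
  · have := hμ.isProb r
    have hu' := Real.sqrt_pos.2 hu
    have hr' := Real.sqrt_pos.2 hr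
    have hbd : ∀ x, |g x * transition μ u g x| ≤ |g x| * (C / Real.sqrt u) := fun x => by
      rw [abs_mul]
      gcongr
      refine (abs_transition_le _ _ _).trans ?_
      rw [le_div_iff₀' hu']
      exact hC u hu x
    have h1 : |transition μ r (fun x => g x * transition μ u g x) 0|
        ≤ transition μ r (fun y => |g y|) 0 * (C / Real.sqrt u) := by
      refine (abs_transition_le _ _ _).trans ?_
      rw [transition, transition, ← integral_mul_const]
      refine integral_mono_of_nonneg (.of_forall fun _ => abs_nonneg _) ?_
        (.of_forall fun y => hbd _)
      refine Integrable.mul_const (Integrable.of_bound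
        (hg.abs.measurable.comp (by fun_prop)).aestronglyMeasurable M (.of_forall fun y => ?_)) _
      simpa using hg.bound (0 + y)
    have h2 : transition μ r (fun y => |g y|) 0 ≤ C / Real.sqrt r := by
      rw [le_div_iff₀' hr']
      exact hC r hr 0
    calc _ ≤ _ := h1
      _ ≤ C / Real.sqrt r * (C / Real.sqrt u) := by gcongr
      _ = _ := by rw [div_mul_div_comm, sq]

/-- In the limit the inner mean forgets its starting point, so the two factors decouple; the uniform
bounds give a dominating multiple of `|g|`. -/
theorem tendsto_pair (hμ : HasExponentLaws μ Ψ) (h : IsAdmissibleExponent Ψ ℓ)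
    (hg : IsNice g M) {r u : ℕ → ℝ} (hr : Tendsto r atTop atTop) (hu : Tendsto u atTop atTop) :
    Tendsto (fun n => Real.sqrt (r n) * Real.sqrt (u n) *
        transition μ (r n) (fun x => g x * transition μ (u n) g x) 0) atTop
      (𝓝 ((IsAdmissibleExponent.llt ℓ * ∫ z, g z) ^ 2)) := by
  obtain ⟨D, hD0, hD⟩ := hμ.exists_sqrt_mul_transition_abs_le h hg
  obtain ⟨C, hC⟩ := h.exists_sqrt_mul_integral_exp_le
  have : Tendsto (fun n => ∫ z, (Real.sqrt (r n) *
      invDensity (fun x => Real.exp (-(r n) * Ψ x)) z) *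
        (g z * (Real.sqrt (u n) * transition μ (u n) g z))) atTop
      (𝓝 (∫ z, IsAdmissibleExponent.llt ℓ * (g z * (IsAdmissibleExponent.llt ℓ * ∫ z, g z)))) := by
    refine tendsto_integral_filter_of_dominated_convergence (fun z => C * (|g z| * D)) ?_ ?_
      ((hg.integrable.abs.mul_const D).const_mul C) (.of_forall fun z => ?_)
    · filter_upwards [hr.eventually_gt_atTop 0] with n hn
      have := continuous_invDensity (h.integrable_exp hn)
      exact ((this.measurable.const_mul _).mul
        (hg.measurable.mul ((hμ.measurable_transition hg.measurable _).const_mul _))).aestronglyMeasurable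
    · filter_upwards [hr.eventually_ge_atTop 1, hu.eventually_gt_atTop 0] with n hn hun
      refine .of_forall fun z => ?_
      have h1 : ‖Real.sqrt (r n) * invDensity (fun x => Real.exp (-(r n) * Ψ x)) z‖ ≤ C := by
        rw [norm_mul, Real.norm_of_nonneg (Real.sqrt_nonneg _)]
        refine le_trans ?_ (hC (r n) hn)
        gcongr
        exact abs_invDensity_le (h.integrable_exp (by linarith)) (fun _ => Real.exp_nonneg _) _
      have h2 : ‖Real.sqrt (u n) * transition μ (u n) g z‖ ≤ D := by
        rw [norm_mul, Real.norm_of_nonneg (Real.sqrt_nonneg _)]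
        refine le_trans ?_ (hD (u n) hun z)
        gcongr
        exact abs_transition_le _ _ _
      rw [norm_mul, norm_mul (g z)]
      exact mul_le_mul h1 (mul_le_mul_of_nonneg_left h2 (norm_nonneg _)) (by positivity)
        ((norm_nonneg _).trans h1)
    · exact ((h.tendsto_sqrt_mul_invDensity z).comp hr).mul
        (((hμ.tendsto_sqrt_mul_transition h hg.integrable z).comp hu).const_mul (g z))
  rw [integral_const_mul, integral_mul_const] at this
  have e : IsAdmissibleExponent.llt ℓ * ((∫ z, g z) * (IsAdmissibleExponent.llt ℓ * ∫ z, g z))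
      = (IsAdmissibleExponent.llt ℓ * ∫ z, g z) ^ 2 := by ring
  rw [e] at this
  refine this.congr' ?_
  filter_upwards [hr.eventually_gt_atTop 0] with n hn
  rw [hμ.transition_eq h hn, ← integral_const_mul]
  refine integral_congr_ae (.of_forall fun z => ?_)
  simp only [sub_zero]
  ring

end HasExponentLaws

/-! ### Joint measurability and the two-time law of the process. -/

variable {Ω : Type*} [MeasurableSpace Ω] {P : Measure Ω} {X : ℝ≥0 → Ω → ℝ}

/-- The right endpoint of the `k`-th grid interval of mesh `1 / (n + 1)`. -/
noncomputable def rightApprox (n : ℕ) (k : ℕ) : ℝ≥0 := ((k : ℝ≥0) + 1) / ((n : ℝ≥0) + 1)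

theorem tendsto_rightApprox (s : ℝ≥0) :
    Tendsto (fun n : ℕ => rightApprox n ⌊((n : ℝ≥0) + 1) * s⌋₊) atTop (𝓝[≥] s) := by
  refine tendsto_nhdsWithin_iff.2 ⟨?_, .of_forall fun n => ?_⟩
  · have h1 : Tendsto (fun n : ℕ => s + 1 / ((n : ℝ≥0) + 1)) atTop (𝓝 (s + 0)) :=
      tendsto_const_nhds.add tendsto_one_div_add_atTop_nhds_zero_nat
    rw [add_zero] at h1
    refine tendsto_of_tendsto_of_tendsto_of_le_of_le tendsto_const_nhds h1 (fun n => ?_)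
      fun n => ?_
    · simp only [rightApprox]
      rw [le_div_iff₀ (by positivity), mul_comm]
      exact (Nat.lt_floor_add_one _).le
    · simp only [rightApprox]
      rw [add_div]
      gcongr
      rw [div_le_iff₀ (by positivity), mul_comm s]
      exact Nat.floor_le (by positivity)
  · simp only [rightApprox, Set.mem_Ici]
    rw [le_div_iff₀ (by positivity), mul_comm]
    exact (Nat.lt_floor_add_one _).le

theorem measurable_comp_countable (hX : ∀ t, Measurable (X t)) (q : ℕ → ℝ≥0)
    {k : ℝ × Ω → ℕ} (hk : Measurable k) : Measurable (fun p : ℝ × Ω => X (q (k p)) p.2) :=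
  (measurable_from_prod_countable_right (f := fun z : ℕ × Ω => X (q z.1) z.2)
    fun n => hX (q n)).comp (hk.prodMk measurable_snd)

/-- Right-continuity makes `X` the limit of its samples at right grid endpoints, each using
countably many times. Off a measurable set of good paths the process is set to `0`. -/
theorem IsLevyProcess.exists_jointly_measurable (hX : IsLevyProcess X P) :
    ∃ Y : ℝ → Ω → ℝ, Measurable (fun p : ℝ × Ω => Y p.1 p.2) ∧
      ∀ᵐ ω ∂P, ∀ s, Y s ω = X s.toNNReal ω := by
  obtain ⟨A, hA, hAm, hAc⟩ : ∃ A : Set Ω, (∀ ω ∈ A, ∀ t : ℝ≥0,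
      ContinuousWithinAt (fun s => X s ω) (Set.Ici t) t) ∧ MeasurableSet A ∧ ∀ᵐ ω ∂P, ω ∈ A := by
    obtain ⟨A, hsub, hAm, hA⟩ := hX.cadlag.exists_measurable_mem
    exact ⟨A, fun ω hω t => (hA ω hω t).1, hAm, hsub⟩
  classical
  refine ⟨fun s ω => if ω ∈ A then X s.toNNReal ω else 0, ?_, ?_⟩
  · refine measurable_of_tendsto_metrizable (f := fun (n : ℕ) (p : ℝ × Ω) =>
      if p.2 ∈ A then X (rightApprox n ⌊((n : ℝ≥0) + 1) * p.1.toNNReal⌋₊) p.2 else 0) (fun n => ?_)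
      (tendsto_pi_nhds.2 fun p => ?_)
    · refine Measurable.ite (measurable_snd hAm) ?_ measurable_const
      exact measurable_comp_countable hX.measurable (rightApprox n)
        (Nat.measurable_floor.comp (by fun_prop))
    · by_cases hp : p.2 ∈ A
      · simp only [hp, if_true]
        exact (hA p.2 hp p.1.toNNReal).tendsto.comp (tendsto_rightApprox p.1.toNNReal)
      · simp only [hp, if_false]
        exact tendsto_const_nhds
  · filter_upwards [hAc] with ω hω s
    simp [hω]

theorem IsLevyProcess.hasExponentLaws [IsProbabilityMeasure P] (hX : IsLevyProcess X P) {Ψ : ℝ → ℝ}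
    (hΨ : HasCharExponent X P Ψ) (heven : ∀ x, Ψ (-x) = Ψ x) :
    HasExponentLaws (fun s => P.map (X s.toNNReal)) Ψ := by
  refine ⟨fun s => Measure.isProbabilityMeasure_map (hX.measurable _).aemeasurable,
    fun s hs x => ?_⟩
  -- The exponent is defined with `exp (-i x X)` but `charFun` with `exp (i x X)`; evenness
  -- reconciles them.
  have h := hΨ s.toNNReal (-x)
  rw [heven, Real.coe_toNNReal _ hs.le] at h
  rw [charFun_apply_real, integral_map (hX.measurable _).aemeasurable (by fun_prop)]
  push_cast
  rw [← h]
  refine integral_congr_ae (.of_forall fun ω => ?_)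
  simp only
  congr 1
  push_cast
  ring

/-- The Markov property at time `r`: the increment after `r` is independent of `X r` and has the law
of `X (s - r)`. -/
theorem IsLevyProcess.integral_pair [IsProbabilityMeasure P] (hX : IsLevyProcess X P) {g : ℝ → ℝ}
    {M : ℝ} (hg : IsNice g M) {r s : ℝ} (hr : 0 ≤ r) (hrs : r ≤ s) :
    ∫ ω, g (X r.toNNReal ω) * g (X s.toNNReal ω) ∂P
      = transition (fun s => P.map (X s.toNNReal)) r (fun x => g x *
          transition (fun s => P.map (X s.toNNReal)) (s - r) g x) 0 := by
  set U := X r.toNNReal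
  set V : Ω → ℝ := fun ω => X s.toNNReal ω - X r.toNNReal ω
  have hU : Measurable U := hX.measurable _
  have hV : Measurable V := (hX.measurable _).sub (hX.measurable _)
  have hind : IndepFun U V P := by
    have h1 := hX.indep_increments.indepFun_sub_sub (r := 0) (s := r.toNNReal) (t := s.toNNReal)
      zero_le (Real.toNNReal_le_toNNReal hrs)
    refine h1.congr ?_ (ae_eq_refl _)
    filter_upwards [hX.start_zero] with ω hω
    simp [U, hω]
  have hlaw : P.map V = P.map (X (s - r).toNNReal) := by
    have h2 := (hX.stationary_increments r.toNNReal (s - r).toNNReal).map_eq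
    rw [← Real.toNNReal_add hr (by linarith), add_sub_cancel] at h2
    exact h2
  have hjoint := (indepFun_iff_map_prod_eq_prod_map_map hU.aemeasurable hV.aemeasurable).1 hind
  have hPU : IsProbabilityMeasure (P.map U) := Measure.isProbabilityMeasure_map hU.aemeasurable
  have hPV : IsProbabilityMeasure (P.map V) := Measure.isProbabilityMeasure_map hV.aemeasurable
  have hm : Measurable (fun p : ℝ × ℝ => g p.1 * g (p.1 + p.2)) :=
    (hg.measurable.comp measurable_fst).mul (hg.measurable.comp (by fun_prop))
  have hint : Integrable (fun p : ℝ × ℝ => g p.1 * g (p.1 + p.2)) ((P.map U).prod (P.map V)) := by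
    refine Integrable.of_bound hm.aestronglyMeasurable (M * M) (.of_forall fun p => ?_)
    rw [norm_mul]
    exact mul_le_mul (hg.bound _) (hg.bound _) (norm_nonneg _) hg.bound_nonneg
  calc
    _ = ∫ p, g p.1 * g (p.1 + p.2) ∂(P.map fun ω => (U ω, V ω)) := by
      rw [integral_map (hU.prodMk hV).aemeasurable hm.aestronglyMeasurable]
      simp [U, V]
    _ = ∫ x, ∫ y, g x * g (x + y) ∂(P.map V) ∂(P.map U) := by
      rw [hjoint, integral_prod _ hint]
    _ = _ := by
      rw [hlaw]
      simp only [transition, zero_add, integral_const_mul, U]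

/-! ### The singular time kernels. -/

/-- This is `B(1/2, 1/2) = Γ(1/2)²`; the scaling exponent `1/2 + 1/2 - 1` vanishes, so `a` drops
out. -/
theorem integral_inv_sqrt_mul_sqrt {a : ℝ} (ha : 0 < a) :
    ∫ x in (0 : ℝ)..a, (Real.sqrt x * Real.sqrt (a - x))⁻¹ = Real.pi := by
  have h := Complex.betaIntegral_scaled (1 / 2) (1 / 2) ha
  have hB : Complex.betaIntegral (1 / 2) (1 / 2) = Real.pi := by
    have h1 := Complex.Gamma_mul_Gamma_eq_betaIntegral (s := 1 / 2) (t := 1 / 2)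
      (by norm_num) (by norm_num)
    rw [Complex.Gamma_one_half_eq, ← Complex.cpow_add _ _ (by simp [Real.pi_ne_zero])] at h1
    norm_num at h1
    norm_num
    exact h1.symm
  rw [hB] at h
  have e : ∫ x in (0 : ℝ)..a, (x : ℂ) ^ ((1 / 2 : ℂ) - 1) * ((a : ℂ) - x) ^ ((1 / 2 : ℂ) - 1)
      = ∫ x in (0 : ℝ)..a, (((Real.sqrt x * Real.sqrt (a - x))⁻¹ : ℝ) : ℂ) := by
    refine intervalIntegral.integral_congr fun x hx => ?_
    rw [Set.uIcc_of_le ha.le] at hx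
    have h2 : ∀ y : ℝ, 0 ≤ y → (y : ℂ) ^ ((1 / 2 : ℂ) - 1) = (((Real.sqrt y)⁻¹ : ℝ) : ℂ) := by
      intro y hy
      rw [Real.sqrt_eq_rpow, ← Real.rpow_neg hy, Complex.ofReal_cpow hy]
      norm_num
    rw [h2 x hx.1, ← Complex.ofReal_sub, h2 (a - x) (by linarith [hx.2])]
    push_cast
    rw [mul_inv]
  rw [e, intervalIntegral.integral_ofReal] at h
  norm_num at h
  simpa [mul_inv] using h

theorem inv_sqrt_eq_rpow {x : ℝ} (hx : 0 ≤ x) : (Real.sqrt x)⁻¹ = x ^ (-(1 / 2) : ℝ) := by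
  rw [Real.sqrt_eq_rpow, ← Real.rpow_neg hx]

theorem intervalIntegrable_inv_sqrt {T : ℝ} (hT : 0 ≤ T) :
    IntervalIntegrable (fun x => (Real.sqrt x)⁻¹) volume 0 T := by
  refine (intervalIntegral.intervalIntegrable_rpow' (r := -(1 / 2)) (by norm_num)).congr ?_
  intro x hx
  rw [Set.uIoc_of_le hT] at hx
  exact (inv_sqrt_eq_rpow hx.1.le).symm

theorem integral_inv_sqrt {T : ℝ} (hT : 0 ≤ T) :
    ∫ x in (0 : ℝ)..T, (Real.sqrt x)⁻¹ = 2 * Real.sqrt T := by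
  have : ∫ x in (0 : ℝ)..T, (Real.sqrt x)⁻¹ = ∫ x in (0 : ℝ)..T, x ^ (-(1 / 2) : ℝ) := by
    refine intervalIntegral.integral_congr fun x hx => ?_
    rw [Set.uIcc_of_le hT] at hx
    exact inv_sqrt_eq_rpow hx.1
  rw [this, integral_rpow (.inl (by norm_num)), Real.sqrt_eq_rpow]
  norm_num
  ring

/-- The singular kernel on the square; it vanishes for `p.1 ≤ p.2` on positive times. -/
theorem integrable_kernel {T : ℝ} (hT : 0 ≤ T) :
    Integrable (fun p : ℝ × ℝ => (Real.sqrt p.2 * Real.sqrt (p.1 - p.2))⁻¹)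
      ((volume.restrict (Set.Ioc 0 T)).prod (volume.restrict (Set.Ioc 0 T))) := by
  set k : ℝ → ℝ := (Set.Ioc 0 T).indicator fun x => (Real.sqrt x)⁻¹
  have hk : Integrable k := by
    rw [integrable_indicator_iff measurableSet_Ioc]
    exact (intervalIntegrable_iff_integrableOn_Ioc_of_le hT).1 (intervalIntegrable_inv_sqrt hT)
  -- The kernel is the integrand of the self-convolution of the integrable `k`, hence integrable on
  -- the plane.
  have h1 := hk.convolution_integrand (ContinuousLinearMap.mul ℝ ℝ) hk
  rw [Measure.prod_restrict]
  refine (h1.integrableOn (s := Set.Ioc 0 T ×ˢ Set.Ioc 0 T)).congr ?_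
  filter_upwards [ae_restrict_mem (measurableSet_Ioc.prod measurableSet_Ioc)] with p hp
  obtain ⟨⟨h1, h2⟩, h3, h4⟩ := hp
  simp only [ContinuousLinearMap.mul_apply', k]
  rw [Set.indicator_of_mem (show p.2 ∈ Set.Ioc 0 T from ⟨h3, h4⟩), mul_inv]
  rcases le_or_gt p.1 p.2 with h | h
  · rw [Set.indicator_of_notMem (fun h' => absurd h'.1 (by linarith)),
      Real.sqrt_eq_zero_of_nonpos (by linarith : p.1 - p.2 ≤ 0), inv_zero]
  · rw [Set.indicator_of_mem (show p.1 - p.2 ∈ Set.Ioc 0 T from ⟨by linarith, by linarith⟩)]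

/-- For fixed `σ` the integrand vanishes at `ρ > σ`, as the square root of a negative number and the
inverse of `0` are both `0`; the inner integral is thus `π` for each `σ`. -/
theorem integral_kernel {T : ℝ} (hT : 0 ≤ T) :
    ∫ p : ℝ × ℝ, (Real.sqrt p.2 * Real.sqrt (p.1 - p.2))⁻¹
      ∂((volume.restrict (Set.Ioc 0 T)).prod (volume.restrict (Set.Ioc 0 T)))
      = Real.pi * T := by
  rw [integral_prod _ (integrable_kernel hT)]
  have : ∀ᵐ σ ∂(volume.restrict (Set.Ioc 0 T)), ∫ ρ in Set.Ioc 0 T,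
      (Real.sqrt ρ * Real.sqrt (σ - ρ))⁻¹ = Real.pi := by
    filter_upwards [ae_restrict_mem measurableSet_Ioc] with σ hσ
    rw [← integral_inv_sqrt_mul_sqrt hσ.1, intervalIntegral.integral_of_le hσ.1.le]
    refine setIntegral_eq_of_subset_of_forall_sdiff_eq_zero measurableSet_Ioc
      (Set.Ioc_subset_Ioc_right hσ.2) fun x hx => ?_
    have : σ < x := by
      by_contra hc
      exact hx.2 ⟨hx.1.1, not_lt.1 hc⟩
    rw [Real.sqrt_eq_zero_of_nonpos (by linarith : σ - x ≤ 0), mul_zero, inv_zero]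
  rw [integral_congr_ae this]
  simp [hT, mul_comm]

/-- The square of an integral as twice the integral over a triangle. -/
theorem sq_integral_eq_two_mul_triangle {ν : Measure ℝ} [IsFiniteMeasure ν] [NullSingletonClass ν]
    {φ : ℝ → ℝ} (hφ : Integrable φ ν) :
    (∫ x, φ x ∂ν) ^ 2
      = 2 * ∫ p : ℝ × ℝ, {p : ℝ × ℝ | p.2 < p.1}.indicator (fun p => φ p.2 * φ p.1) p
          ∂(ν.prod ν) := by
  set D : Set (ℝ × ℝ) := {p | p.2 < p.1}
  set H : ℝ × ℝ → ℝ := fun p => φ p.2 * φ p.1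
  have hD : MeasurableSet D := measurableSet_lt measurable_snd measurable_fst
  have hH : Integrable H (ν.prod ν) := by
    simpa only [H, mul_comm] using hφ.mul_prod hφ
  have h1 : (∫ x, φ x ∂ν) ^ 2 = ∫ p, H p ∂(ν.prod ν) := by
    rw [sq, ← integral_prod_mul]
    simp only [H, mul_comm]
  -- `H` is symmetric under the swap, and the diagonal is null because `ν` has no atoms.
  have h2 : ∫ p, Dᶜ.indicator H p ∂(ν.prod ν) = ∫ p, D.indicator H p ∂(ν.prod ν) := by
    rw [← integral_prod_swap]
    refine integral_congr_ae ?_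
    have hdiag : ∀ᵐ p ∂(ν.prod ν), p.2 ≠ p.1 := by
      refine (Measure.ae_prod_iff_ae_ae (p := fun p : ℝ × ℝ => p.2 ≠ p.1)
        (measurableSet_eq_fun measurable_snd measurable_fst).compl).2 (.of_forall fun x => ?_)
      simp [ae_iff]
    filter_upwards [hdiag] with p hp
    by_cases hpD : p ∈ D
    · have : p.swap ∈ Dᶜ := fun h => lt_asymm (show p.2 < p.1 from hpD) h
      rw [Set.indicator_of_mem this, Set.indicator_of_mem hpD]
      simp [H, mul_comm]
    · have : p.swap ∉ Dᶜ := fun h => h (lt_of_le_of_ne (not_lt.1 hpD) hp.symm)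
      rw [Set.indicator_of_notMem this, Set.indicator_of_notMem hpD]
  rw [h1, ← integral_add_compl hD hH, ← integral_indicator hD, ← integral_indicator hD.compl, h2,
    two_mul]

variable {Ω : Type*} [MeasurableSpace Ω] {P : Measure Ω}

/-! ### Moments of time integrals by Fubini. -/

section Moments

variable {ν : Measure ℝ} [IsFiniteMeasure ν] {Z : ℝ → Ω → ℝ} {M : ℝ}

theorem integrable_section (hZ : Measurable fun p : ℝ × Ω => Z p.1 p.2)
    (hM : ∀ s ω, |Z s ω| ≤ M) (ω : Ω) : Integrable (fun s => Z s ω) ν :=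
  Integrable.of_bound (hZ.comp (by fun_prop : Measurable fun s : ℝ => (s, ω))).aestronglyMeasurable M
    (.of_forall fun s => hM s ω)

theorem measurable_integral_section (hZ : Measurable fun p : ℝ × Ω => Z p.1 p.2) :
    Measurable (fun ω => ∫ s, Z s ω ∂ν) :=
  (StronglyMeasurable.integral_prod_left' (f := fun p : ℝ × Ω => Z p.1 p.2)
    hZ.stronglyMeasurable).measurable

theorem integral_integral_process [IsProbabilityMeasure P]
    (hZ : Measurable fun p : ℝ × Ω => Z p.1 p.2) (hM : ∀ s ω, |Z s ω| ≤ M) :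
    ∫ ω, (∫ s, Z s ω ∂ν) ∂P = ∫ s, (∫ ω, Z s ω ∂P) ∂ν := by
  refine (integral_integral_swap ?_).symm
  exact Integrable.of_bound hZ.aestronglyMeasurable M (.of_forall fun p => hM p.1 p.2)

theorem integral_sq_integral_process [IsProbabilityMeasure P] [NullSingletonClass ν]
    (hZ : Measurable fun p : ℝ × Ω => Z p.1 p.2) (hM : ∀ s ω, |Z s ω| ≤ M) :
    ∫ ω, (∫ s, Z s ω ∂ν) ^ 2 ∂P
      = 2 * ∫ p : ℝ × ℝ, {p : ℝ × ℝ | p.2 < p.1}.indicator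
          (fun p => ∫ ω, Z p.2 ω * Z p.1 ω ∂P) p ∂(ν.prod ν) := by
  set D : Set (ℝ × ℝ) := {p | p.2 < p.1}
  have hD : MeasurableSet D := measurableSet_lt measurable_snd measurable_fst
  have h1 : ∀ ω, (∫ s, Z s ω ∂ν) ^ 2
      = 2 * ∫ p : ℝ × ℝ, D.indicator (fun p => Z p.2 ω * Z p.1 ω) p ∂(ν.prod ν) :=
    fun ω => sq_integral_eq_two_mul_triangle (integrable_section hZ hM ω)
  simp_rw [h1, integral_const_mul]
  congr 1
  rw [integral_integral_swap]
  · refine integral_congr_ae (.of_forall fun p => ?_)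
    by_cases hp : p ∈ D <;> simp [hp]
  · have hm : Measurable (fun q : Ω × (ℝ × ℝ) => Z q.2.2 q.1 * Z q.2.1 q.1) :=
      (hZ.comp (by fun_prop : Measurable fun q : Ω × (ℝ × ℝ) => (q.2.2, q.1))).mul
        (hZ.comp (by fun_prop : Measurable fun q : Ω × (ℝ × ℝ) => (q.2.1, q.1)))
    have e : (Function.uncurry fun (ω : Ω) (p : ℝ × ℝ) => D.indicator (fun p => Z p.2 ω * Z p.1 ω) p)
        = (Prod.snd ⁻¹' D).indicator (fun q : Ω × (ℝ × ℝ) => Z q.2.2 q.1 * Z q.2.1 q.1) := by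
      funext q
      rfl
    rw [e]
    refine Integrable.indicator ?_ (measurable_snd hD)
    refine Integrable.of_bound hm.aestronglyMeasurable (M * M) (.of_forall fun q => ?_)
    rw [norm_mul]
    exact mul_le_mul (hM _ _) (hM _ _) (norm_nonneg _) ((abs_nonneg _).trans (hM q.2.2 q.1))

theorem measurable_pair_mean [SFinite P] (hZ : Measurable fun p : ℝ × Ω => Z p.1 p.2) :
    Measurable (fun p : ℝ × ℝ => ∫ ω, Z p.2 ω * Z p.1 ω ∂P) :=
  (StronglyMeasurable.integral_prod_right'
    (f := fun q : (ℝ × ℝ) × Ω => Z q.1.2 q.2 * Z q.1.1 q.2) (ν := P)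
    ((hZ.comp (by fun_prop : Measurable fun q : (ℝ × ℝ) × Ω => (q.1.2, q.2))).mul
        (hZ.comp (by fun_prop : Measurable fun q : (ℝ × ℝ) × Ω =>
          (q.1.1, q.2)))).stronglyMeasurable).measurable

theorem measurable_mean [SFinite P] (hZ : Measurable fun p : ℝ × Ω => Z p.1 p.2) :
    Measurable (fun s : ℝ => ∫ ω, Z s ω ∂P) :=
  (StronglyMeasurable.integral_prod_right' (f := fun q : ℝ × Ω => Z q.1 q.2) (ν := P)
    hZ.stronglyMeasurable).measurable

end Moments

/-! ### Scaling limits of the two moments. -/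

section Limits

variable {X : ℝ≥0 → Ω → ℝ} [IsProbabilityMeasure P] {Y : ℝ → Ω → ℝ} {Ψ : ℝ → ℝ} {ℓ : ℝ}
  {g : ℝ → ℝ} {M : ℝ} {a : ℕ → ℝ}

theorem tendsto_first_moment (hX : IsLevyProcess X P)
    (hμ : HasExponentLaws (fun s => P.map (X s.toNNReal)) Ψ) (h : IsAdmissibleExponent Ψ ℓ)
    (hg : IsNice g M) (hY : Measurable (fun p : ℝ × Ω => Y p.1 p.2))
    (hYX : ∀ᵐ ω ∂P, ∀ s, Y s ω = X s.toNNReal ω)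
    (ha_pos : ∀ n, 0 < a n) (ha_lim : Tendsto a atTop atTop) {T : ℝ} (hT : 0 ≤ T) :
    Tendsto (fun n => ∫ ω, (a n * ∫ ρ in Set.Ioc 0 T, g (Y (a n ^ 2 * ρ) ω)) ∂P) atTop
      (𝓝 (IsAdmissibleExponent.llt ℓ * (∫ x, g x) * (2 * Real.sqrt T))) := by
  have hZ : ∀ n, Measurable fun p : ℝ × Ω => g (Y (a n ^ 2 * p.1) p.2) := fun n =>
    hg.measurable.comp (hY.comp
      (by fun_prop : Measurable fun p : ℝ × Ω => (a n ^ 2 * p.1, p.2)))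
  obtain ⟨C, hC0, hC, -⟩ := hμ.exists_abs_pair_le h hg
  set m := fun s => transition (fun s => P.map (X s.toNNReal)) s g 0
  have hmean : ∀ s, ∫ ω, g (Y s ω) ∂P = m s := fun s => by
    simp only [m, transition, zero_add]
    rw [integral_map (hX.measurable _).aemeasurable hg.measurable.aestronglyMeasurable]
    refine integral_congr_ae ?_
    filter_upwards [hYX] with ω hω
    rw [hω]
  have hE : ∀ n, ∫ ω, (a n * ∫ ρ in Set.Ioc 0 T, g (Y (a n ^ 2 * ρ) ω)) ∂P
      = ∫ ρ in Set.Ioc 0 T, a n * m (a n ^ 2 * ρ) := fun n => by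
    rw [integral_const_mul, integral_const_mul, integral_integral_process
      (Z := fun ρ ω => g (Y (a n ^ 2 * ρ) ω)) (hZ n) (fun _ _ => hg.bound _)]
    simp only [hmean]
  simp_rw [hE]
  have hlimval : IsAdmissibleExponent.llt ℓ * (∫ x, g x) * (2 * Real.sqrt T)
      = ∫ ρ in Set.Ioc 0 T, IsAdmissibleExponent.llt ℓ * (∫ x, g x) * (Real.sqrt ρ)⁻¹ := by
    rw [integral_const_mul, ← intervalIntegral.integral_of_le hT, integral_inv_sqrt hT]
  rw [hlimval]
  have hsq : ∀ n ρ, 0 < ρ → Real.sqrt (a n ^ 2 * ρ) = a n * Real.sqrt ρ := fun n ρ hρ => by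
    rw [Real.sqrt_mul (sq_nonneg _), Real.sqrt_sq (ha_pos n).le]
  -- The mean at time `a² ρ` is at most `C / (a √ρ)`, so the prefactor `a` cancels exactly.
  refine tendsto_integral_of_dominated_convergence (fun ρ => C * (Real.sqrt ρ)⁻¹) (fun n => ?_) ?_
    (fun n => ?_) ?_
  · refine (Measurable.const_mul ?_ _).aestronglyMeasurable
    have := measurable_mean (P := P) (Z := fun ρ ω => g (Y (a n ^ 2 * ρ) ω)) (hZ n)
    simpa only [hmean] using this
  · exact ((intervalIntegrable_iff_integrableOn_Ioc_of_le hT).1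
      (intervalIntegrable_inv_sqrt hT)).const_mul C
  · filter_upwards [ae_restrict_mem measurableSet_Ioc] with ρ hρ
    have han := ha_pos n
    have hρ' := Real.sqrt_pos.2 hρ.1
    rw [norm_mul, Real.norm_of_nonneg han.le]
    have h1 := hC (a n ^ 2 * ρ) (mul_pos (by positivity) hρ.1)
    rw [hsq n ρ hρ.1] at h1
    calc a n * ‖m (a n ^ 2 * ρ)‖ ≤ a n * (C / (a n * Real.sqrt ρ)) := by gcongr; exact h1
      _ = C * (Real.sqrt ρ)⁻¹ := by field_simp
  · filter_upwards [ae_restrict_mem measurableSet_Ioc] with ρ hρ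
    have hρ' := Real.sqrt_pos.2 hρ.1
    have hlim : Tendsto (fun n => a n ^ 2 * ρ) atTop atTop :=
      ((tendsto_pow_atTop two_ne_zero).comp ha_lim).atTop_mul_const hρ.1
    have h1 := ((hμ.tendsto_sqrt_mul_transition h hg.integrable 0).comp hlim).mul_const
      (Real.sqrt ρ)⁻¹
    refine h1.congr fun n => ?_
    simp only [Function.comp, hsq n ρ hρ.1, m]
    field_simp

theorem tendsto_second_moment (hX : IsLevyProcess X P)
    (hμ : HasExponentLaws (fun s => P.map (X s.toNNReal)) Ψ) (h : IsAdmissibleExponent Ψ ℓ)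
    (hg : IsNice g M) (hY : Measurable (fun p : ℝ × Ω => Y p.1 p.2))
    (hYX : ∀ᵐ ω ∂P, ∀ s, Y s ω = X s.toNNReal ω)
    (ha_pos : ∀ n, 0 < a n) (ha_lim : Tendsto a atTop atTop) {T : ℝ} (hT : 0 ≤ T) :
    Tendsto (fun n => ∫ ω, (a n * ∫ ρ in Set.Ioc 0 T, g (Y (a n ^ 2 * ρ) ω)) ^ 2 ∂P) atTop
      (𝓝 (2 * ((IsAdmissibleExponent.llt ℓ * ∫ x, g x) ^ 2 * (Real.pi * T)))) := by
  set ν : Measure ℝ := volume.restrict (Set.Ioc 0 T)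
  set D : Set (ℝ × ℝ) := {p | p.2 < p.1}
  have hD : MeasurableSet D := measurableSet_lt measurable_snd measurable_fst
  have hZ : ∀ n, Measurable fun p : ℝ × Ω => g (Y (a n ^ 2 * p.1) p.2) := fun n =>
    hg.measurable.comp (hY.comp
      (by fun_prop : Measurable fun p : ℝ × Ω => (a n ^ 2 * p.1, p.2)))
  obtain ⟨C, hC0, -, hC⟩ := hμ.exists_abs_pair_le h hg
  set G := fun r u => transition (fun s => P.map (X s.toNNReal)) r (fun x => g x *
          transition (fun s => P.map (X s.toNNReal)) u g x) 0
  have hmean : ∀ r s, 0 ≤ r → r ≤ s → ∫ ω, g (Y r ω) * g (Y s ω) ∂P = G r (s - r) := by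
    intro r s hr hrs
    simp only [G]
    rw [← hX.integral_pair hg hr hrs]
    refine integral_congr_ae ?_
    filter_upwards [hYX] with ω hω
    rw [hω, hω]
  have hE : ∀ n, ∫ ω, (a n * ∫ ρ, g (Y (a n ^ 2 * ρ) ω) ∂ν) ^ 2 ∂P
      = 2 * ∫ p : ℝ × ℝ, a n ^ 2 * D.indicator
          (fun p => ∫ ω, g (Y (a n ^ 2 * p.2) ω) * g (Y (a n ^ 2 * p.1) ω) ∂P) p ∂(ν.prod ν) :=
    fun n => by
    simp_rw [mul_pow]
    rw [integral_const_mul, integral_const_mul, integral_sq_integral_process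
      (Z := fun ρ ω => g (Y (a n ^ 2 * ρ) ω)) (hZ n) (fun _ _ => hg.bound _)]
    ring
  simp_rw [hE]
  refine Tendsto.const_mul 2 ?_
  rw [← integral_kernel hT, ← integral_const_mul]
  have hsq : ∀ n ρ, Real.sqrt (a n ^ 2 * ρ) = a n * Real.sqrt ρ := fun n ρ => by
    rw [Real.sqrt_mul (sq_nonneg _), Real.sqrt_sq (ha_pos n).le]
  have hmem : ∀ᵐ p ∂(ν.prod ν), p ∈ Set.Ioc 0 T ×ˢ Set.Ioc 0 T := by
    simp only [ν, Measure.prod_restrict]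
    exact ae_restrict_mem (measurableSet_Ioc.prod measurableSet_Ioc)
  have hpair : ∀ n (p : ℝ × ℝ), 0 < p.2 → p.2 < p.1 →
      ∫ ω, g (Y (a n ^ 2 * p.2) ω) * g (Y (a n ^ 2 * p.1) ω) ∂P
        = G (a n ^ 2 * p.2) (a n ^ 2 * (p.1 - p.2)) := fun n p h0 hp => by
    have := ha_pos n
    rw [hmean _ _ (by positivity) (by gcongr), mul_sub]
  -- On the triangle the two-time bound at `a² ρ` and `a² (σ - ρ)` cancels the factor `a²`; off it,
  -- integrand and kernel are both zero.
  refine tendsto_integral_of_dominated_convergence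
    (fun p => C ^ 2 * (Real.sqrt p.2 * Real.sqrt (p.1 - p.2))⁻¹) (fun n => ?_)
    ((integrable_kernel hT).const_mul _) (fun n => ?_) ?_
  · refine (Measurable.const_mul (Measurable.indicator ?_ hD) _).aestronglyMeasurable
    exact measurable_pair_mean (Z := fun ρ ω => g (Y (a n ^ 2 * ρ) ω)) (hZ n)
  · filter_upwards [hmem] with p hp
    have han := ha_pos n
    by_cases hpD : p ∈ D
    · have hpD' : 0 < p.1 - p.2 := sub_pos.2 hpD
      have h1 := hC (a n ^ 2 * p.2) (a n ^ 2 * (p.1 - p.2)) (mul_pos (by positivity) hp.2.1)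
        (by positivity)
      have hs1 := Real.sqrt_pos.2 hp.2.1
      have hs2 := Real.sqrt_pos.2 hpD'
      rw [Set.indicator_of_mem hpD, hpair n p hp.2.1 hpD, norm_mul,
        Real.norm_of_nonneg (sq_nonneg _)]
      rw [hsq, hsq] at h1
      calc _ ≤ a n ^ 2 * (C ^ 2 / (a n * Real.sqrt p.2 * (a n * Real.sqrt (p.1 - p.2)))) := by
            gcongr
            exact h1
        _ = _ := by field_simp
    · rw [Set.indicator_of_notMem hpD, mul_zero, norm_zero]
      positivity
  · filter_upwards [hmem] with p hp
    by_cases hpD : p ∈ D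
    · have hpD' : 0 < p.1 - p.2 := sub_pos.2 hpD
      have hs1 := Real.sqrt_pos.2 hp.2.1
      have hs2 := Real.sqrt_pos.2 hpD'
      have hsqlim : Tendsto (fun n => a n ^ 2) atTop atTop :=
        (tendsto_pow_atTop two_ne_zero).comp ha_lim
      have h1 := (hμ.tendsto_pair h hg (hsqlim.atTop_mul_const hp.2.1)
        (hsqlim.atTop_mul_const hpD')).mul_const (Real.sqrt p.2 * Real.sqrt (p.1 - p.2))⁻¹
      refine h1.congr fun n => ?_
      rw [Set.indicator_of_mem hpD, hpair n p hp.2.1 hpD, hsq, hsq]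
      simp only [G]
      field_simp
    · have : Real.sqrt (p.1 - p.2) = 0 :=
        Real.sqrt_eq_zero_of_nonpos (sub_nonpos.2 (not_lt.1 hpD))
      simp [Set.indicator_of_notMem hpD, this]

end Limits

/-! ### Reduction to a bounded Borel function. -/

/-- An integrable essentially bounded function has a bounded Borel modification. -/
theorem IsAdmissibleFunction.exists_isNice {f : ℝ → ℝ} (hf : IsAdmissibleFunction f) :
    ∃ g M, IsNice g M ∧ f =ᵐ[volume] g := by
  set g0 := hf.integrable.1.mk f
  have hg0 : Measurable g0 := hf.integrable.1.stronglyMeasurable_mk.measurable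
  have hfg : f =ᵐ[volume] g0 := hf.integrable.1.ae_eq_mk
  set M := (eLpNorm f ∞ volume).toReal
  have hM : ∀ᵐ x, |f x| ≤ M := by
    have h1 : eLpNorm f ∞ volume ≠ ∞ := hf.essBounded.2.ne
    rw [eLpNorm_exponent_top] at h1
    filter_upwards [enorm_ae_le_eLpNormEssSup f volume] with x hx
    have := ENNReal.toReal_mono h1 hx
    simpa [M, eLpNorm_exponent_top] using this
  set S : Set ℝ := {x | |g0 x| ≤ M}
  have hS : MeasurableSet S := measurableSet_le hg0.abs measurable_const
  have hfg' : f =ᵐ[volume] S.indicator g0 := by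
    filter_upwards [hfg, hM] with x hx hxM
    rw [Set.indicator_of_mem (show x ∈ S from by simpa [S, ← hx] using hxM), hx]
  refine ⟨S.indicator g0, M, ⟨hg0.indicator hS, hf.integrable.congr hfg', fun x => ?_⟩, hfg'⟩
  by_cases hx : x ∈ S
  · rw [Set.indicator_of_mem hx]
    exact hx
  · rw [Set.indicator_of_notMem hx, abs_zero]
    exact ENNReal.toReal_nonneg

/-- Almost surely, modifying `f` on a null set does not change `f (X s)` at almost every time. -/
theorem ae_ae_eq_comp {X : ℝ≥0 → Ω → ℝ} [IsProbabilityMeasure P] {Y : ℝ → Ω → ℝ} {Ψ : ℝ → ℝ}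
    {ℓ : ℝ} (hX : IsLevyProcess X P)
    (hμ : HasExponentLaws (fun s => P.map (X s.toNNReal)) Ψ) (h : IsAdmissibleExponent Ψ ℓ)
    (hY : Measurable (fun p : ℝ × Ω => Y p.1 p.2))
    (hYX : ∀ᵐ ω ∂P, ∀ s, Y s ω = X s.toNNReal ω) {f g : ℝ → ℝ} (hfg : f =ᵐ[volume] g) :
    ∀ᵐ ω ∂P, ∀ᵐ s : ℝ, 0 < s → f (X s.toNNReal ω) = g (Y s ω) := by
  obtain ⟨A, hA, hAm, hsub⟩ := hfg.exists_measurable_mem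
  -- At each fixed `s > 0` absolute continuity of the law avoids the null set; Fubini then exchanges
  -- the quantifiers. Time `0` is excluded since `X 0` is almost surely `0`.
  have h1 : ∀ᵐ s : ℝ, ∀ᵐ ω ∂P, 0 < s → Y s ω ∈ A := by
    refine .of_forall fun s => ?_
    by_cases hs : 0 < s
    · have h2 : ∀ᵐ x ∂(P.map (X s.toNNReal)), x ∈ A := (hμ.absolutelyContinuous h hs).ae_le hA
      have h3 := ae_of_ae_map (hX.measurable _).aemeasurable h2
      filter_upwards [h3, hYX] with ω h4 h5 _
      rw [h5]
      exact h4
    · exact .of_forall fun ω h' => absurd h' hs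
  have h2 : ∀ᵐ ω ∂P, ∀ᵐ s : ℝ, 0 < s → Y s ω ∈ A := by
    refine (Measure.ae_ae_comm ?_).1 h1
    have e : {x : ℝ × Ω | 0 < x.1 → Y x.1 x.2 ∈ A}
        = {x | 0 < x.1}ᶜ ∪ (fun p : ℝ × Ω => Y p.1 p.2) ⁻¹' A := by
      ext x
      simp only [Set.mem_ofPred_eq, Set.mem_union, Set.mem_compl_iff, Set.mem_preimage]
      tauto
    rw [e]
    exact (measurableSet_lt measurable_const measurable_fst).compl.union (hY hAm)
  filter_upwards [h2, hYX] with ω hω hω'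
  filter_upwards [hω] with s hs hs0
  rw [← hω' s]
  exact hsub (Y s ω) (hs hs0)

end LevyFunctional

/-! ### Assembly of the theorem. -/

open LevyFunctional in
theorem corollary1p1 {Ω : Type*} [MeasurableSpace Ω] (P : Measure Ω) [IsProbabilityMeasure P]
    (X : ℝ≥0 → Ω → ℝ) (hX : LevyFunctional.IsLevyProcess X P)
    (hsymm : LevyFunctional.IsSymmetricProcess X P)
    (Ψ : ℝ → ℝ) (hΨ : LevyFunctional.HasCharExponent X P Ψ)
    (ℓ : ℝ) (hadm : LevyFunctional.IsAdmissibleExponent Ψ ℓ)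
    (f : ℝ → ℝ) (hf : LevyFunctional.IsAdmissibleFunction f)
    (a : ℕ → ℝ) (ha_pos : ∀ n, 0 < a n) (ha_mono : Monotone a) (ha_lim : Tendsto a atTop atTop)
    (t : ℝ) (ht : 0 < t) :
    (∀ n, ∀ᵐ ω ∂P, IntervalIntegrable (fun s : ℝ => f (X s.toNNReal ω)) volume
        0 (t ^ 2 * a n ^ 2)) ∧
    (∀ n, MemLp (LevyFunctional.additiveFunctional X f (a n) t) 2 P) ∧
    Tendsto (fun n => ∫ ω, LevyFunctional.additiveFunctional X f (a n) t ω ∂P) atTop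
      (𝓝 ((∫ x, f x) * (t / Real.sqrt (Real.pi * ℓ)))) ∧
    Tendsto (fun n => ∫ ω, (LevyFunctional.additiveFunctional X f (a n) t ω) ^ 2 ∂P) atTop
      (𝓝 ((∫ x, f x) ^ 2 * (t ^ 2 / (2 * ℓ)))) := by
  obtain ⟨Y, hY, hYX⟩ := hX.exists_jointly_measurable
  obtain ⟨g, M, hg, hfg⟩ := hf.exists_isNice
  have hμ := hX.hasExponentLaws hΨ hadm.apply_neg
  have hae := ae_ae_eq_comp hX hμ hadm hY hYX hfg
  have hZ : Measurable fun p : ℝ × Ω => g (Y p.1 p.2) := hg.measurable.comp hY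
  have hT : 0 ≤ t ^ 2 := sq_nonneg t
  -- The substitution `s = a² ρ` turns the prefactor `a⁻¹` into `a` and fixes the time interval.
  have hfun : ∀ n, additiveFunctional X f (a n) t
      =ᵐ[P] fun ω => a n * ∫ ρ in Set.Ioc 0 (t ^ 2), g (Y (a n ^ 2 * ρ) ω) := fun n => by
    filter_upwards [hae] with ω hω
    have han := ha_pos n
    have h1 : ∫ s in (0 : ℝ)..(t ^ 2 * a n ^ 2), f (X s.toNNReal ω)
        = ∫ s in (0 : ℝ)..(t ^ 2 * a n ^ 2), g (Y s ω) := by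
      refine intervalIntegral.integral_congr_ae ?_
      filter_upwards [hω] with s hs hmem
      rw [Set.uIoc_of_le (by positivity)] at hmem
      exact hs hmem.1
    rw [additiveFunctional, h1, ← intervalIntegral.integral_of_le hT,
      intervalIntegral.integral_comp_mul_left (fun s => g (Y s ω)) (by positivity), smul_eq_mul,
      mul_zero, mul_comm (a n ^ 2) (t ^ 2)]
    field_simp
  have hF : ∫ x, f x = ∫ x, g x := integral_congr_ae hfg
  have hl := hadm.ell_pos
  refine ⟨fun n => ?_, fun n => ?_, ?_, ?_⟩
  · have han := ha_pos n
    filter_upwards [hae] with ω hω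
    rw [intervalIntegrable_iff_integrableOn_Ioc_of_le (by positivity)]
    refine (integrable_section hZ (fun _ _ => hg.bound _) ω).congr ?_
    rw [EventuallyEq, ae_restrict_iff' measurableSet_Ioc]
    filter_upwards [hω] with s hs hmem
    exact (hs hmem.1).symm
  · rw [memLp_congr_ae (hfun n)]
    have hZn : Measurable fun p : ℝ × Ω => g (Y (a n ^ 2 * p.1) p.2) :=
      hZ.comp (by fun_prop : Measurable fun p : ℝ × Ω => (a n ^ 2 * p.1, p.2))
    refine MemLp.const_mul ?_ _
    refine MemLp.of_bound (measurable_integral_section hZn).aestronglyMeasurable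
      (M * (volume.restrict (Set.Ioc 0 (t ^ 2))).real Set.univ) (.of_forall fun ω => ?_)
    exact norm_integral_le_of_norm_le_const (.of_forall fun s => hg.bound _)
  · have h1 := tendsto_first_moment hX hμ hadm hg hY hYX ha_pos ha_lim hT
    have e : IsAdmissibleExponent.llt ℓ * (∫ x, g x) * (2 * Real.sqrt (t ^ 2))
        = (∫ x, f x) * (t / Real.sqrt (Real.pi * ℓ)) := by
      rw [hF, Real.sqrt_sq ht.le, IsAdmissibleExponent.llt]
      field_simp
    rw [e] at h1
    exact h1.congr fun n => (integral_congr_ae (hfun n)).symm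
  · have h1 := tendsto_second_moment hX hμ hadm hg hY hYX ha_pos ha_lim hT
    -- Here `llt ℓ ^ 2 = 1 / (4 π ℓ)`, so the `π` of the Beta integral cancels.
    have e : 2 * ((IsAdmissibleExponent.llt ℓ * ∫ x, g x) ^ 2 * (Real.pi * t ^ 2))
        = (∫ x, f x) ^ 2 * (t ^ 2 / (2 * ℓ)) := by
      rw [hF, IsAdmissibleExponent.llt, mul_pow, inv_pow, mul_pow, Real.sq_sqrt (by positivity)]
      field_simp
    rw [e] at h1
    refine h1.congr fun n => integral_congr_ae ?_
    filter_upwards [hfun n] with ω hω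
    rw [hω]
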